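/- \textbf{Setting.} An order (a bid or an ask) has an id, a timestamp, a limit price and a quantity, all natural numbers, the quantity being at least $1$. The input consists of a list $B$ of bids and a list $A$ of asks, all orders having distinct ids and distinct timestamps. A transaction consists of a bid, an ask, a transaction quantity and a transaction price. A bid $b$ and an ask $a$ are tradable if $\mathrm{price}(b)\ge \mathrm{price}(a)$. A finite set $M$ of transactions is a matching over $(B,A)$ if every transaction of $M$ is between a bid from $B$ and an ask from $A$ that are tradable, and for every order $w$ in $B\cup A$ the total quantity of the transactions of $M$ involving $w$ is at most the quantity of $w$. The volume of $M$ is the sum of all its transaction quantities. \textbf{Model.} The prices of the input orders are not given to the algorithm explicitly (all the rest of the input is). In the \emph{comparison model}, the algorithm can have the prices of two orders of its choice compared by an oracle in unit time. In the \emph{binary query model}, it can have an oracle evaluate, in unit time, any function $f:\mathbb N\times\mathbb N\to\{0,1\}$ of its choice on the prices of two orders of its choice. Transactions are output by naming the bid, the ask, the quantity, and a transaction price, which is an explicit number or a copy of the limit price of an order. The worst-case running time on $n$ orders is the supremum of the running time over all inputs with $|B|+|A|=n$. \textbf{Theorem.} Every (deterministic) algorithm that, on each input $(B,A)$, computes a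 matching over $(B,A)$ of maximum volume has worst-case running time $\Omega(n\log n)$ in the comparison model and $\Omega(n\sqrt{\log n})$ in the binary query model, where $n=|B|+|A|$. That is, in each of the two models there are constants $c>0$ and $n_0$ such that for every such algorithm and every $n\ge n_0$ there is an input with $n$ orders on which the algorithm runs for time at least $c\,n\log n$ (respectively, at least $c\,n\sqrt{\log n}$). -/

import Mathlib

namespace Exchange

/-- An order (a bid or an ask): an identification number, a timestamp, a limit price and a
quantity, all natural numbers, the quantity being at least one. -/
structure TradeOrder where
  id : ℕ
  timestamp : ℕ
  price : ℕ
  qty : ℕ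
  qty_pos : 1 ≤ qty
  deriving DecidableEq

/-- A transaction between a bid and an ask, with a transaction quantity and a transaction
price. -/
structure Transaction where
  bid : TradeOrder
  ask : TradeOrder
  qty : ℕ
  price : ℕ
  deriving DecidableEq

/-- A bid and an ask are tradable if the limit price of the bid is at least that of the ask. -/
def Tradable (b a : TradeOrder) : Prop := a.price ≤ b.price

/-- `Qty(w, M)`: the total quantity of the transactions of `M` that involve `w`. -/
def tradedQty (w : TradeOrder) (M : Finset Transaction) : ℕ :=
  ∑ m ∈ M with m.bid = w ∨ m.ask = w, m.qty

/-- `Vol(M)`: the total quantity of all transactions of `M`. -/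
def volume (M : Finset Transaction) : ℕ := ∑ m ∈ M, m.qty

/-- An input: a list of bids and a list of asks; all orders have distinct ids and distinct
timestamps. -/
structure Market where
  bids : List TradeOrder
  asks : List TradeOrder
  nodup_ids : ((bids ++ asks).map TradeOrder.id).Nodup
  nodup_timestamps : ((bids ++ asks).map TradeOrder.timestamp).Nodup

/-- The number of orders in the input. -/
def Market.size (I : Market) : ℕ := I.bids.length + I.asks.length

/-- `M` is a matching over the bids and asks of `I`. Nothing is demanded of the transaction
prices; since a tradable pair always admits a transaction price between its limit prices,
demanding that would only make the task of computing a maximum volume matching harder. -/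
structure IsMatching (I : Market) (M : Finset Transaction) : Prop where
  bid_mem : ∀ m ∈ M, m.bid ∈ I.bids
  ask_mem : ∀ m ∈ M, m.ask ∈ I.asks
  tradable : ∀ m ∈ M, Tradable m.bid m.ask
  qty_le : ∀ w ∈ I.bids ++ I.asks, tradedQty w M ≤ w.qty

/-- `M` is a matching whose volume is the largest among all matchings. -/
def IsMaxVolumeMatching (I : Market) (M : Finset Transaction) : Prop :=
  IsMatching I M ∧ ∀ M' : Finset Transaction, IsMatching I M' → volume M' ≤ volume M

/-! ### What an algorithm sees of its input, and how it refers to it -/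

/-- Everything about an order except its price. -/
structure OrderInfo where
  id : ℕ
  timestamp : ℕ
  qty : ℕ

def TradeOrder.info (w : TradeOrder) : OrderInfo := ⟨w.id, w.timestamp, w.qty⟩

/-- The explicitly given part of the input: the bids and the asks without their prices. -/
structure PublicInput where
  bids : List OrderInfo
  asks : List OrderInfo

def Market.publicInput (I : Market) : PublicInput :=
  ⟨I.bids.map TradeOrder.info, I.asks.map TradeOrder.info⟩

/-- A reference to an order of the input, by its position in the list of bids or of asks. -/
inductive OrderRef where
  | bid (i : ℕ)
  | ask (j : ℕ)

/-- The hidden price of the order referred to (`none` if there is no such order). -/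
def Market.price? (I : Market) : OrderRef → Option ℕ
  | .bid i => I.bids[i]?.map TradeOrder.price
  | .ask j => I.asks[j]?.map TradeOrder.price

/-- How an algorithm writes a transaction price: as an explicit number, or as a copy of the
(hidden) limit price of an order. -/
inductive PriceTerm where
  | const (p : ℕ)
  | priceOf (x : OrderRef)

def PriceTerm.value? (I : Market) : PriceTerm → Option ℕ
  | .const p => some p
  | .priceOf x => I.price? x

/-- A transaction as written by an algorithm: between the `bid`-th bid and the `ask`-th ask. -/
structure TransactionTerm where
  bid : ℕ
  ask : ℕ
  qty : ℕ
  price : PriceTerm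

/-- On the input `I`, the written transaction `τ` stands for the transaction `m`. -/
def TransactionTerm.Denotes (I : Market) (τ : TransactionTerm) (m : Transaction) : Prop :=
  I.bids[τ.bid]? = some m.bid ∧ I.asks[τ.ask]? = some m.ask ∧
    τ.qty = m.qty ∧ τ.price.value? I = some m.price

/-- On the input `I`, the list `out` is a list of transactions that makes up the set `M`. -/
def OutputDenotes (I : Market) (out : List TransactionTerm) (M : Finset Transaction) : Prop :=
  (∀ τ ∈ out, ∃ m ∈ M, τ.Denotes I m) ∧ (∀ m ∈ M, ∃ τ ∈ out, τ.Denotes I m)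

/-! ### Algorithms with an oracle for the prices -/

/-- A kind of access to hidden prices: a question of type `Query` about an ordered pair of
prices is answered by an element of `Answer`. -/
structure PriceOracle where
  Query : Type
  Answer : Type
  eval : Query → ℕ → ℕ → Answer

/-- The comparison model: two prices can be compared, the answer being `<`, `=` or `>`. -/
def comparisonModel : PriceOracle where
  Query := Unit
  Answer := Ordering
  eval _ p q := compare p q

/-- The binary query model: any function `f : ℕ × ℕ → {0, 1}` can be evaluated on two prices. -/
def binaryQueryModel : PriceOracle where
  Query := ℕ → ℕ → Bool
  Answer := Bool
  eval f p q := f p q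

/-- What an algorithm does in a given state: stop with an output, make a step of computation of
its own, or query the oracle on the prices of two orders and continue according to the
answer. -/
inductive Action (O : PriceOracle) (State : Type) where
  | halt (out : List TransactionTerm)
  | compute (next : State)
  | query (f : O.Query) (x y : OrderRef) (next : O.Answer → State)

/-- A (deterministic) algorithm: an abstract machine with an arbitrary set of states, whose
initial state depends only on the explicitly given part of the input, and which learns about
the prices only through the oracle. -/
structure Algorithm (O : PriceOracle) where
  State : Type
  init : PublicInput → State
  action : State → Action O State

/-- `A.RunsFrom I s t out`: on the input `I` and from the state `s`, the algorithm stops with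
the output `out` after exactly `t` steps, where each step of computation and each oracle query
takes unit time. (A query about a nonexistent order never returns.) -/
inductive Algorithm.RunsFrom {O : PriceOracle} (A : Algorithm O) (I : Market) :
    A.State → ℕ → List TransactionTerm → Prop
  | halt {s : A.State} {out : List TransactionTerm} (h : A.action s = .halt out) :
      A.RunsFrom I s 0 out
  | compute {s s' : A.State} {t : ℕ} {out : List TransactionTerm}
      (h : A.action s = .compute s') (hrun : A.RunsFrom I s' t out) :
      A.RunsFrom I s (t + 1) out
  | query {s : A.State} {f : O.Query} {x y : OrderRef} {next : O.Answer → A.State} {p q t : ℕ}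
      {out : List TransactionTerm} (h : A.action s = .query f x y next)
      (hx : I.price? x = some p) (hy : I.price? y = some q)
      (hrun : A.RunsFrom I (next (O.eval f p q)) t out) :
      A.RunsFrom I s (t + 1) out

/-- On the input `I` the algorithm stops with output `out` after running for time `t`. -/
def Algorithm.Runs {O : PriceOracle} (A : Algorithm O) (I : Market) (t : ℕ)
    (out : List TransactionTerm) : Prop :=
  A.RunsFrom I (A.init I.publicInput) t out

/-- On every input the algorithm stops and outputs a matching of maximum volume. -/
def Algorithm.ComputesMaxVolumeMatching {O : PriceOracle} (A : Algorithm O) : Prop :=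
  ∀ I : Market, ∃ (t : ℕ) (out : List TransactionTerm) (M : Finset Transaction),
    A.Runs I t out ∧ OutputDenotes I out M ∧ IsMaxVolumeMatching I M

/-- The worst-case running time of `A` on inputs with `n` orders is at least `r`: on some such
input, `A` runs for time at least `r`. -/
def Algorithm.WorstCaseTimeAtLeast {O : PriceOracle} (A : Algorithm O) (n : ℕ) (r : ℝ) : Prop :=
  ∃ I : Market, I.size = n ∧
    ∃ (t : ℕ) (out : List TransactionTerm), A.Runs I t out ∧ r ≤ (t : ℝ)

end Exchange

/-!
Bids of prices `1, …, m` and unit quantity face asks of the same prices in a secret order. Pairing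
equal prices sells out all asks, so a matching of maximum volume sells them all out; since the bids
are in total worth no more than the asks, it can then only trade at equal prices. A correct output
therefore reveals the secret permutation. An algorithm whose queries have at most `k` possible
answers has at most `k ^ T` outputs available within time `T`, hence needs time `log_k m!`.
For `n = 2m` or `n = 2m + 1` orders this is of order `n log n`, for binary queries as well.
-/

namespace Exchange

open Filter Finset
open scoped Nat

section DecisionTree

variable {O : PriceOracle} {A : Algorithm O} {s : A.State}

/-- The outputs that `A` can reach from the state `s` in time at most `T`, whatever the hidden
prices are: the leaves of the decision tree of `A` up to depth `T`. -/
def Algorithm.outputsWithin (A : Algorithm O) (s : A.State) (T : ℕ) :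
    Set (List TransactionTerm) :=
  {out | ∃ I : Market, ∃ t ≤ T, A.RunsFrom I s t out}

theorem Algorithm.outputsWithin_zero_subsingleton : (A.outputsWithin s 0).Subsingleton := by
  rintro out ⟨I, t, ht, hrun⟩ out' ⟨I', t', ht', hrun'⟩
  obtain rfl := Nat.le_zero.1 ht
  obtain rfl := Nat.le_zero.1 ht'
  cases hrun
  cases hrun'
  simp_all

theorem Algorithm.outputsWithin_subset_of_halt {out : List TransactionTerm} {T : ℕ}
    (h : A.action s = .halt out) : A.outputsWithin s T ⊆ {out} := by
  rintro out' ⟨I, t, -, hrun⟩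
  cases hrun <;> simp_all

theorem Algorithm.outputsWithin_succ_subset_of_compute {s' : A.State} {T : ℕ}
    (h : A.action s = .compute s') : A.outputsWithin s (T + 1) ⊆ A.outputsWithin s' T := by
  rintro out ⟨I, t, ht, hrun⟩
  cases hrun with
  | halt h' => simp_all
  | compute h' hrun =>
    cases h.symm.trans h'
    exact ⟨I, _, Nat.le_of_succ_le_succ ht, hrun⟩
  | query h' => simp_all

theorem Algorithm.outputsWithin_succ_subset_of_query {f : O.Query} {x y : OrderRef}
    {next : O.Answer → A.State} {T : ℕ} (h : A.action s = .query f x y next) :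
    A.outputsWithin s (T + 1) ⊆ ⋃ a, A.outputsWithin (next a) T := by
  rintro out ⟨I, t, ht, hrun⟩
  cases hrun with
  | halt h' => simp_all
  | compute h' => simp_all
  | query h' hx hy hrun =>
    cases h.symm.trans h'
    exact Set.mem_iUnion.2 ⟨_, I, _, Nat.le_of_succ_le_succ ht, hrun⟩

theorem Algorithm.encard_outputsWithin_le [Finite O.Answer] {k : ℕ} (hk : 0 < k)
    (hO : Nat.card O.Answer ≤ k) (A : Algorithm O) (s : A.State) (T : ℕ) :
    (A.outputsWithin s T).encard ≤ (k ^ T : ℕ) := by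
  have one_le_pow (T : ℕ) : (1 : ℕ∞) ≤ (k ^ T : ℕ) := by exact_mod_cast Nat.one_le_pow T k hk
  induction T generalizing s with
  | zero =>
    exact (Set.encard_le_one_iff_subsingleton.2 outputsWithin_zero_subsingleton).trans
      (one_le_pow 0)
  | succ T ih =>
    cases h : A.action s with
    | halt out =>
      calc (A.outputsWithin s (T + 1)).encard ≤ Set.encard {out} :=
            Set.encard_le_encard (outputsWithin_subset_of_halt h)
        _ = 1 := Set.encard_singleton out
        _ ≤ (k ^ (T + 1) : ℕ) := one_le_pow (T + 1)
    | compute s' =>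
      calc (A.outputsWithin s (T + 1)).encard ≤ (A.outputsWithin s' T).encard :=
            Set.encard_le_encard (outputsWithin_succ_subset_of_compute h)
        _ ≤ (k ^ T : ℕ) := ih s'
        _ ≤ (k ^ (T + 1) : ℕ) := by exact_mod_cast Nat.pow_le_pow_right hk T.le_succ
    | query f x y next =>
      have := Fintype.ofFinite O.Answer
      calc (A.outputsWithin s (T + 1)).encard ≤ (⋃ a, A.outputsWithin (next a) T).encard :=
            Set.encard_le_encard (outputsWithin_succ_subset_of_query h)
        _ ≤ ∑ a, (A.outputsWithin (next a) T).encard := Set.encard_iUnion_le_of_fintype _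
        _ ≤ ∑ _a : O.Answer, ((k ^ T : ℕ) : ℕ∞) := sum_le_sum fun a _ => ih (next a)
        _ = (Nat.card O.Answer * k ^ T : ℕ) := by simp
        _ ≤ (k ^ (T + 1) : ℕ) := by
          rw [pow_succ']
          exact_mod_cast Nat.mul_le_mul_right _ hO

/-- `out` is a correct answer to the problem of computing a maximum volume matching over `I`. -/
def IsCorrectOutput (I : Market) (out : List TransactionTerm) : Prop :=
  ∃ M : Finset Transaction, OutputDenotes I out M ∧ IsMaxVolumeMatching I M

theorem Algorithm.ComputesMaxVolumeMatching.exists_runs_card_le_pow [Finite O.Answer] {k : ℕ}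
    (hk : 0 < k) (hO : Nat.card O.Answer ≤ k) (hA : A.ComputesMaxVolumeMatching)
    {ι : Type*} [Finite ι] [Nonempty ι] {I : ι → Market} {P : PublicInput}
    (hP : ∀ i, (I i).publicInput = P)
    (hI : ∀ i j out, IsCorrectOutput (I i) out → IsCorrectOutput (I j) out → i = j) :
    ∃ i t out, A.Runs (I i) t out ∧ Nat.card ι ≤ k ^ t := by
  choose t out M hrun hout hM using fun i => hA (I i)
  have out_injective : Function.Injective out := fun i j h =>
    hI i j (out i) ⟨M i, hout i, hM i⟩ (h ▸ ⟨M j, hout j, hM j⟩)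
  obtain ⟨i, hi⟩ := Finite.exists_max t
  refine ⟨i, t i, out i, hrun i, ?_⟩
  have range_subset : Set.range out ⊆ A.outputsWithin (A.init P) (t i) := by
    rintro _ ⟨j, rfl⟩
    exact ⟨I j, t j, hi j, hP j ▸ hrun j⟩
  have := (Set.encard_le_encard range_subset).trans (A.encard_outputsWithin_le hk hO _ _)
  rw [← Set.image_univ, out_injective.encard_image, Set.encard_univ, ENat.card_eq_coe_natCard]
    at this
  exact_mod_cast this

end DecisionTree

section Matching

variable {I : Market} {M : Finset Transaction}

theorem Market.nodup_bids_append_asks (I : Market) : (I.bids ++ I.asks).Nodup :=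
  I.nodup_ids.of_map

theorem Market.ne_of_mem_bids_of_mem_asks {b a : TradeOrder} (hb : b ∈ I.bids)
    (ha : a ∈ I.asks) : b ≠ a := fun h =>
  List.disjoint_of_nodup_append I.nodup_bids_append_asks hb (h ▸ ha)

theorem IsMatching.tradedQty_of_mem_bids (hM : IsMatching I M) {b : TradeOrder}
    (hb : b ∈ I.bids) : tradedQty b M = ∑ x ∈ M with x.bid = b, x.qty := by
  refine sum_congr (filter_congr fun x hx => or_iff_left ?_) fun _ _ => rfl
  exact (Market.ne_of_mem_bids_of_mem_asks hb (hM.ask_mem x hx)).symm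

theorem IsMatching.tradedQty_of_mem_asks (hM : IsMatching I M) {a : TradeOrder}
    (ha : a ∈ I.asks) : tradedQty a M = ∑ x ∈ M with x.ask = a, x.qty := by
  refine sum_congr (filter_congr fun x hx => or_iff_right ?_) fun _ _ => rfl
  exact Market.ne_of_mem_bids_of_mem_asks (hM.bid_mem x hx) ha

theorem IsMatching.sum_qty_mul_bid (hM : IsMatching I M) (f : TradeOrder → ℕ) :
    ∑ x ∈ M, x.qty * f x.bid = ∑ b ∈ I.bids.toFinset, tradedQty b M * f b := by
  rw [← sum_fiberwise_of_maps_to fun x hx => List.mem_toFinset.2 (hM.bid_mem x hx)]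
  refine sum_congr rfl fun b hb => ?_
  rw [hM.tradedQty_of_mem_bids (List.mem_toFinset.1 hb), sum_mul]
  exact sum_congr rfl fun x hx => by rw [(mem_filter.1 hx).2]

theorem IsMatching.sum_qty_mul_ask (hM : IsMatching I M) (f : TradeOrder → ℕ) :
    ∑ x ∈ M, x.qty * f x.ask = ∑ a ∈ I.asks.toFinset, tradedQty a M * f a := by
  rw [← sum_fiberwise_of_maps_to fun x hx => List.mem_toFinset.2 (hM.ask_mem x hx)]
  refine sum_congr rfl fun a ha => ?_
  rw [hM.tradedQty_of_mem_asks (List.mem_toFinset.1 ha), sum_mul]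
  exact sum_congr rfl fun x hx => by rw [(mem_filter.1 hx).2]

theorem IsMatching.tradedQty_ask_eq_qty (hM : IsMatching I M)
    (hvol : ∑ a ∈ I.asks.toFinset, a.qty ≤ volume M) {a : TradeOrder} (ha : a ∈ I.asks) :
    tradedQty a M = a.qty := by
  have tradedQty_le : ∀ a ∈ I.asks.toFinset, tradedQty a M ≤ a.qty := fun a ha =>
    hM.qty_le a (List.mem_append_right _ (List.mem_toFinset.1 ha))
  have volume_eq : volume M = ∑ a ∈ I.asks.toFinset, tradedQty a M := by
    simpa [volume] using hM.sum_qty_mul_ask fun _ => 1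
  exact (sum_eq_sum_iff_of_le tradedQty_le).1
    (le_antisymm (sum_le_sum tradedQty_le) (volume_eq ▸ hvol)) a (List.mem_toFinset.2 ha)

/-- Some matching sells out all asks, and the bids are in total worth no more than the asks. This
forces every maximum volume matching to trade at equal limit prices only. -/
structure Market.IsBalanced (I : Market) : Prop where
  exists_isMatching : ∃ M, IsMatching I M ∧ ∑ a ∈ I.asks.toFinset, a.qty ≤ volume M
  worth_le : ∑ b ∈ I.bids.toFinset, b.qty * b.price ≤ ∑ a ∈ I.asks.toFinset, a.qty * a.price

theorem IsMaxVolumeMatching.tradedQty_ask_eq_qty (hM : IsMaxVolumeMatching I M)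
    (hI : I.IsBalanced) {a : TradeOrder} (ha : a ∈ I.asks) : tradedQty a M = a.qty := by
  obtain ⟨M', hM', hvol⟩ := hI.exists_isMatching
  exact hM.1.tradedQty_ask_eq_qty (hvol.trans (hM.2 M' hM')) ha

theorem IsMaxVolumeMatching.bid_price_eq_ask_price (hM : IsMaxVolumeMatching I M)
    (hI : I.IsBalanced) {x : Transaction} (hx : x ∈ M) (hq : 0 < x.qty) :
    x.bid.price = x.ask.price := by
  have trade_le : ∀ x ∈ M, x.qty * x.ask.price ≤ x.qty * x.bid.price := fun x hx =>
    Nat.mul_le_mul_left _ (hM.1.tradable x hx)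
  have sum_bid_le_sum_ask :
      ∑ x ∈ M, x.qty * x.bid.price ≤ ∑ x ∈ M, x.qty * x.ask.price :=
    calc ∑ x ∈ M, x.qty * x.bid.price
        = ∑ b ∈ I.bids.toFinset, tradedQty b M * b.price := hM.1.sum_qty_mul_bid _
      _ ≤ ∑ b ∈ I.bids.toFinset, b.qty * b.price := sum_le_sum fun b hb =>
          Nat.mul_le_mul_right _
            (hM.1.qty_le b (List.mem_append_left _ (List.mem_toFinset.1 hb)))
      _ ≤ ∑ a ∈ I.asks.toFinset, a.qty * a.price := hI.worth_le
      _ = ∑ a ∈ I.asks.toFinset, tradedQty a M * a.price := sum_congr rfl fun a ha => by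
          rw [hM.tradedQty_ask_eq_qty hI (List.mem_toFinset.1 ha)]
      _ = ∑ x ∈ M, x.qty * x.ask.price := (hM.1.sum_qty_mul_ask _).symm
  have trade_eq := (sum_eq_sum_iff_of_le trade_le).1
    (le_antisymm (sum_le_sum trade_le) sum_bid_le_sum_ask) x hx
  exact (Nat.eq_of_mul_eq_mul_left hq trade_eq).symm

end Matching

section Output

variable {I I' : Market} {out : List TransactionTerm}

theorem IsCorrectOutput.exists_mem_ask_eq (h : IsCorrectOutput I out) (hI : I.IsBalanced) {j : ℕ}
    (hj : j < I.asks.length) : ∃ τ ∈ out, τ.ask = j ∧ 0 < τ.qty := by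
  obtain ⟨M, hout, hM⟩ := h
  have ask_mem : I.asks[j] ∈ I.asks := List.getElem_mem hj
  have sum_pos : 0 < ∑ x ∈ M with x.ask = I.asks[j], x.qty := by
    rw [← hM.1.tradedQty_of_mem_asks ask_mem, hM.tradedQty_ask_eq_qty hI ask_mem]
    exact I.asks[j].qty_pos
  obtain ⟨x, hx, hq⟩ := exists_ne_zero_of_sum_ne_zero sum_pos.ne'
  obtain ⟨hxM, hxj⟩ := mem_filter.1 hx
  obtain ⟨τ, hτ, -, hask, hqty, -⟩ := hout.2 x hxM
  refine ⟨τ, hτ, ?_, hqty ▸ Nat.pos_of_ne_zero hq⟩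
  obtain ⟨hlt, hget⟩ := List.getElem?_eq_some_iff.1 hask
  exact (I.nodup_bids_append_asks.of_append_right.getElem_inj_iff).1 (hget.trans hxj)

theorem IsCorrectOutput.price?_ask_eq_price?_bid (h : IsCorrectOutput I out)
    (hI : I.IsBalanced) {τ : TransactionTerm} (hτ : τ ∈ out) (hq : 0 < τ.qty) :
    I.price? (.ask τ.ask) = I.price? (.bid τ.bid) := by
  obtain ⟨M, hout, hM⟩ := h
  obtain ⟨x, hx, hbid, hask, hqty, -⟩ := hout.1 τ hτ
  simp only [Market.price?, hbid, hask, Option.map_some,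
    hM.bid_price_eq_ask_price hI hx (hqty ▸ hq)]

theorem IsCorrectOutput.price?_ask_eq_of_bids_eq (h : IsCorrectOutput I out) (hI : I.IsBalanced)
    (h' : IsCorrectOutput I' out) (hI' : I'.IsBalanced) (hbids : I.bids = I'.bids) {j : ℕ}
    (hj : j < I.asks.length) : I.price? (.ask j) = I'.price? (.ask j) := by
  obtain ⟨τ, hτ, rfl, hq⟩ := h.exists_mem_ask_eq hI hj
  calc I.price? (.ask τ.ask) = I.price? (.bid τ.bid) := h.price?_ask_eq_price?_bid hI hτ hq
    _ = I'.price? (.bid τ.bid) := by simp only [Market.price?, hbids]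
    _ = I'.price? (.ask τ.ask) := (h'.price?_ask_eq_price?_bid hI' hτ hq).symm

end Output

section UnitMarket

variable {a b : ℕ}

/-- An order of quantity one whose id and timestamp are both `i`. -/
def unitOrder (i price : ℕ) : TradeOrder := ⟨i, i, price, 1, le_rfl⟩

theorem nodup_ofFn_append_ofFn_add (a b : ℕ) :
    (List.ofFn (fun i : Fin a => (i : ℕ)) ++ List.ofFn fun j : Fin b => a + (j : ℕ)).Nodup := by
  refine List.Nodup.append (List.nodup_ofFn.2 Fin.val_injective)
    (List.nodup_ofFn.2 fun i j h => Fin.ext (Nat.add_left_cancel h)) fun x hx hx' => ?_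
  obtain ⟨i, rfl⟩ := List.mem_ofFn.1 hx
  obtain ⟨j, hj⟩ := List.mem_ofFn.1 hx'
  omega

/-- The market of `a` bids of prices `p` and `b` asks of prices `q`, all of quantity one. Its
orders are numbered consecutively, so that only the prices distinguish two such markets. -/
def unitMarket (p : Fin a → ℕ) (q : Fin b → ℕ) : Market where
  bids := List.ofFn fun i => unitOrder i (p i)
  asks := List.ofFn fun j => unitOrder (a + j) (q j)
  nodup_ids := by
    simpa [List.map_ofFn, Function.comp_def, unitOrder] using nodup_ofFn_append_ofFn_add a b
  nodup_timestamps := by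
    simpa [List.map_ofFn, Function.comp_def, unitOrder] using nodup_ofFn_append_ofFn_add a b

variable (p : Fin a → ℕ) (q : Fin b → ℕ)

theorem size_unitMarket : (unitMarket p q).size = a + b := by
  simp [Market.size, unitMarket]

theorem publicInput_unitMarket_eq (p' : Fin a → ℕ) (q' : Fin b → ℕ) :
    (unitMarket p q).publicInput = (unitMarket p' q').publicInput := by
  simp only [Market.publicInput, unitMarket, List.map_ofFn]
  rfl

theorem sum_bids_unitMarket (f : TradeOrder → ℕ) :
    ∑ w ∈ (unitMarket p q).bids.toFinset, f w = ∑ i : Fin a, f (unitOrder i (p i)) := by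
  rw [List.sum_toFinset f (unitMarket p q).nodup_bids_append_asks.of_append_left]
  simp [unitMarket, List.map_ofFn, List.sum_ofFn]

theorem sum_asks_unitMarket (f : TradeOrder → ℕ) :
    ∑ w ∈ (unitMarket p q).asks.toFinset, f w = ∑ j : Fin b, f (unitOrder (a + j) (q j)) := by
  rw [List.sum_toFinset f (unitMarket p q).nodup_bids_append_asks.of_append_right]
  simp [unitMarket, List.map_ofFn, List.sum_ofFn]

/-- The matching over `unitMarket p q` that sells the `j`-th ask to the `e j`-th bid; the
transaction price is immaterial. -/
def assignment (e : Fin b → Fin a) : Finset Transaction :=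
  univ.image fun j => ⟨unitOrder (e j) (p (e j)), unitOrder (a + j) (q j), 1, 0⟩

theorem sum_assignment (e : Fin b → Fin a) (f : Transaction → ℕ) :
    ∑ x ∈ assignment p q e, f x =
      ∑ j : Fin b, f ⟨unitOrder (e j) (p (e j)), unitOrder (a + j) (q j), 1, 0⟩ := by
  refine sum_image fun i _ j _ h => Fin.ext (Nat.add_left_cancel (n := a) ?_)
  exact congrArg (fun x : Transaction => x.ask.id) h

theorem volume_assignment (e : Fin b → Fin a) : volume (assignment p q e) = b := by
  simp [volume, sum_assignment]

variable {p q} {e : Fin b → Fin a}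

theorem tradedQty_assignment_le_one (he : e.Injective) (w : TradeOrder) :
    tradedQty w (assignment p q e) ≤ 1 := by
  rw [tradedQty, sum_filter, sum_assignment, ← sum_filter, sum_const, smul_eq_mul, mul_one]
  have id_eq {j : Fin b} (hj : unitOrder (e j) (p (e j)) = w ∨ unitOrder (a + j) (q j) = w) :
      (e j : ℕ) = w.id ∨ a + j = w.id :=
    hj.imp (congrArg TradeOrder.id) (congrArg TradeOrder.id)
  refine card_le_one.2 fun i hi j hj => ?_
  rcases id_eq (mem_filter.1 hi).2 with hi | hi <;> rcases id_eq (mem_filter.1 hj).2 with hj | hj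
  · exact he (Fin.ext (hi.trans hj.symm))
  all_goals omega

theorem isMatching_assignment (he : e.Injective) (h : ∀ j, q j ≤ p (e j)) :
    IsMatching (unitMarket p q) (assignment p q e) where
  bid_mem := by simp [assignment, unitMarket]
  ask_mem := by simp [assignment, unitMarket]
  tradable := by simpa [assignment, Tradable, unitOrder] using h
  qty_le w _ := (tradedQty_assignment_le_one he w).trans w.qty_pos

theorem isBalanced_unitMarket_comp (he : e.Injective) (hp : ∀ i ∉ Set.range e, p i = 0) :
    (unitMarket p (p ∘ e)).IsBalanced where
  exists_isMatching := by
    refine ⟨_, isMatching_assignment he fun j => le_rfl, ?_⟩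
    simp [volume_assignment, sum_asks_unitMarket, unitOrder]
  worth_le := by
    rw [sum_bids_unitMarket, sum_asks_unitMarket]
    simpa [unitOrder] using (Fintype.sum_of_injective e he (p ∘ e) p hp fun _ => rfl).ge

theorem IsCorrectOutput.ask_prices_eq {q' : Fin b → ℕ} {out : List TransactionTerm}
    (h : IsCorrectOutput (unitMarket p q) out) (hq : (unitMarket p q).IsBalanced)
    (h' : IsCorrectOutput (unitMarket p q') out) (hq' : (unitMarket p q').IsBalanced) :
    q = q' := by
  funext j
  have hj : (j : ℕ) < (unitMarket p q).asks.length := by simp [unitMarket]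
  simpa [Market.price?, unitMarket, unitOrder] using h.price?_ask_eq_of_bids_eq hq h' hq' rfl hj

end UnitMarket

section PermutedMarket

variable {m k : ℕ}

/-- The hard instances: bids of prices `m, …, 1`, followed by `k` bids of price `0` (through
truncated subtraction), and asks of prices `m, …, 1` permuted by `σ`. -/
def permutedMarket (k : ℕ) (σ : Equiv.Perm (Fin m)) : Market :=
  unitMarket (fun i : Fin (m + k) => m - i) fun j => m - σ j

theorem isBalanced_permutedMarket (σ : Equiv.Perm (Fin m)) :
    (permutedMarket k σ).IsBalanced := by
  refine isBalanced_unitMarket_comp (e := Fin.castAdd k ∘ σ)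
    ((Fin.castAdd_injective m k).comp σ.injective) fun i hi => Nat.sub_eq_zero_of_le ?_
  by_contra! him
  exact hi ⟨σ.symm ⟨i, him⟩, by simp⟩

theorem IsCorrectOutput.perm_eq {σ σ' : Equiv.Perm (Fin m)} {out : List TransactionTerm}
    (h : IsCorrectOutput (permutedMarket k σ) out)
    (h' : IsCorrectOutput (permutedMarket k σ') out) : σ = σ' := by
  have ask_prices := h.ask_prices_eq (isBalanced_permutedMarket σ) h' (isBalanced_permutedMarket σ')
  ext j
  have := congrFun ask_prices j
  omega

end PermutedMarket

section Asymptotics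

/-- The `Ω(f)` of the paper: `f` is, up to a constant factor, a lower bound on the worst-case time
of computing a maximum volume matching with the oracle `O`. The constants `c` and `n₀` depend on
`O` and `f` only, not on the algorithm. -/
def MatchingTimeOmega (O : PriceOracle) (f : ℕ → ℝ) : Prop :=
  ∃ c : ℝ, 0 < c ∧ ∃ n₀ : ℕ, ∀ A : Algorithm O, A.ComputesMaxVolumeMatching →
    ∀ n : ℕ, n₀ ≤ n → A.WorstCaseTimeAtLeast n (c * f n)

theorem MatchingTimeOmega.of_eventually_le_mul {O : PriceOracle} {f g : ℕ → ℝ} {C : ℝ}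
    (hg : MatchingTimeOmega O g) (hC : 0 < C) (hfg : ∀ᶠ n in atTop, f n ≤ C * g n) :
    MatchingTimeOmega O f := by
  obtain ⟨c, hc, n₀, h⟩ := hg
  obtain ⟨n₁, hn₁⟩ := eventually_atTop.1 hfg
  refine ⟨c / C, by positivity, max n₀ n₁, fun A hA n hn => ?_⟩
  obtain ⟨I, hI, t, out, hrun, ht⟩ := h A hA n (le_of_max_le_left hn)
  refine ⟨I, hI, t, out, hrun, le_trans ?_ ht⟩
  calc c / C * f n ≤ c / C * (C * g n) := by gcongr; exact hn₁ n (le_of_max_le_right hn)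
    _ = c * g n := by field_simp

theorem matchingTimeOmega_log_factorial (O : PriceOracle) [Finite O.Answer] :
    MatchingTimeOmega O fun n => Real.log (n / 2)! := by
  let k := Nat.card O.Answer + 2
  have log_k_pos : 0 < Real.log k := Real.log_pos (by exact_mod_cast (by omega : 1 < k))
  refine ⟨1 / Real.log k, by positivity, 0, fun A hA n _ => ?_⟩
  obtain ⟨σ, t, out, hrun, hcard⟩ := hA.exists_runs_card_le_pow (k := k) (by omega) (by omega)
    (I := fun σ : Equiv.Perm (Fin (n / 2)) => permutedMarket (n % 2) σ)
    (fun _ => publicInput_unitMarket_eq _ _ 0 0) fun _ _ _ => IsCorrectOutput.perm_eq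
  refine ⟨_, (size_unitMarket _ _).trans (by omega), t, out, hrun, ?_⟩
  rw [one_div_mul_eq_div, div_le_iff₀ log_k_pos, ← Real.log_pow]
  rw [Nat.card_perm, Nat.card_fin] at hcard
  exact Real.log_le_log (by exact_mod_cast Nat.factorial_pos _) (by exact_mod_cast hcard)

theorem tendsto_log_natCast_atTop : Tendsto (fun n : ℕ => Real.log n) atTop atTop :=
  Real.tendsto_log_atTop.comp tendsto_natCast_atTop_atTop

theorem mul_log_sub_one_le_log_factorial {m : ℕ} (hm : m ≠ 0) :
    m * (Real.log m - 1) ≤ Real.log m ! := by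
  have stirling := Stirling.le_log_factorial_stirling hm
  have log_m_nonneg := Real.log_natCast_nonneg m
  have log_two_pi_nonneg : 0 ≤ Real.log (2 * Real.pi) :=
    Real.log_nonneg (by linarith [Real.pi_gt_three])
  linarith

theorem eventually_mul_log_le_log_factorial_half :
    ∀ᶠ n : ℕ in atTop, n * Real.log n ≤ 6 * Real.log (n / 2)! := by
  filter_upwards [tendsto_log_natCast_atTop.eventually_ge_atTop 6, eventually_ge_atTop 2]
    with n hlog hn
  have n_pos : (0 : ℝ) < n := by exact_mod_cast (by omega : 0 < n)
  have third_le_half : (n : ℝ) / 3 ≤ (n / 2 : ℕ) := by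
    rw [div_le_iff₀ (by norm_num)]
    exact_mod_cast (by omega : n ≤ n / 2 * 3)
  have log_three_le : Real.log 3 ≤ 2 :=
    (Real.log_le_sub_one_of_pos (by norm_num)).trans_eq (by norm_num)
  have log_half_ge : Real.log n - Real.log 3 ≤ Real.log (n / 2 : ℕ) := by
    rw [← Real.log_div n_pos.ne' (by norm_num)]
    exact Real.log_le_log (by positivity) third_le_half
  calc n * Real.log n = 6 * (n / 3 * (Real.log n / 2)) := by ring
    _ ≤ 6 * ((n / 2 : ℕ) * (Real.log (n / 2 : ℕ) - 1)) := by
      gcongr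
      linarith
    _ ≤ 6 * Real.log (n / 2)! := by
      gcongr
      exact mul_log_sub_one_le_log_factorial (by omega)

theorem eventually_mul_sqrt_log_le_mul_log :
    ∀ᶠ n : ℕ in atTop, n * √(Real.log n) ≤ n * Real.log n := by
  filter_upwards [tendsto_log_natCast_atTop.eventually_ge_atTop 1] with n hlog
  gcongr
  exact Real.sqrt_le_iff.2 ⟨by linarith, le_self_pow₀ hlog two_ne_zero⟩

end Asymptotics

instance : Finite comparisonModel.Answer := inferInstanceAs (Finite Ordering)

instance : Finite binaryQueryModel.Answer := inferInstanceAs (Finite Bool)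

end Exchange

theorem theorem3_general (O : Exchange.PriceOracle) [Finite O.Answer] :
    Exchange.MatchingTimeOmega O fun n => n * Real.log n :=
  (Exchange.matchingTimeOmega_log_factorial O).of_eventually_le_mul (by norm_num)
    Exchange.eventually_mul_log_le_log_factorial_half

theorem theorem3 :
    (∃ c : ℝ, 0 < c ∧ ∃ n₀ : ℕ,
      ∀ A : Exchange.Algorithm Exchange.comparisonModel, A.ComputesMaxVolumeMatching →
        ∀ n : ℕ, n₀ ≤ n → A.WorstCaseTimeAtLeast n (c * ((n : ℝ) * Real.log n))) ∧
    (∃ c : ℝ, 0 < c ∧ ∃ n₀ : ℕ,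
      ∀ A : Exchange.Algorithm Exchange.binaryQueryModel, A.ComputesMaxVolumeMatching →
        ∀ n : ℕ, n₀ ≤ n → A.WorstCaseTimeAtLeast n (c * ((n : ℝ) * √(Real.log n)))) :=
  ⟨theorem3_general _, (theorem3_general _).of_eventually_le_mul one_pos <| by
    simpa only [one_mul] using Exchange.eventually_mul_sqrt_log_le_mul_log⟩
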